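/- **Definitions.** A plane tree is a planar map with exactly one face, up to orientation-preserving homeomorphism of the sphere; its vertices of degree $1$ are called leaves, the others inner vertices, and an inner edge is an edge joining two inner vertices. An *eulerian tree* is a plane tree with at least one inner vertex, rooted on a leaf, with leaves coloured black or white, such that the root leaf is black, every inner vertex has even degree, and every inner vertex of degree $2i$ is adjacent to exactly $i-1$ white leaves. For a finitely supported sequence $\mathbf d=(d_1,d_2,\dots)$ of non-negative integers, it has degree distribution $\mathbf d$ if it has exactly $d_i$ inner vertices of degree $2i$ for every $i\ge 1$. The word $\omega(T)\in\{b,w\}^*$ of $T$ is obtained by following the border of $T$ counterclockwise, ending at the root leaf, and writing $b$ for a black leaf and $w$ for a white one. A word is correct if it has as many $w$ as $b$ and each of its prefixes has at least as many $w$ as $b$. A black leaf is *free* if the tree rerooted at it has a word of the form $p_1bp_2b$ with $p_1,p_2$ correct (there are exactly two free leaves); $T$ is *balanced* if its root leaf is free. *Rerooting sign.* Let $T$ be a balanced eulerian tree with root leaf $r$ and a marked black leaf $l$ (possibly $l=r$). Its sign is $+$ if $r$ is the first free leaf encountered when following the border of $T$ clockwise from $l$, and $-$ otherwise. If $l$ is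 itself free, fix once and for all one of the two conventions: $l$ counts as the first leaf encountered, or as the last one. Conversely, given the unrooted tree with marked black leaf $l$, *rooting it with sign $\varepsilon$ from $l$* means rooting it at the first free leaf encountered clockwise from $l$ if $\varepsilon=+$, and at the other free leaf if $\varepsilon=-$. *Merging $\varphi$.* Let $(T_1,l_1),(T_2,l_2)$ be balanced eulerian trees with a marked black leaf each, with rerooting signs $\varepsilon_1,\varepsilon_2$. Merge $l_1$ and $l_2$ into an edge $\vec e$, oriented from $T_1$ to $T_2$, and root the resulting tree $T$ at the first free leaf of $T$ seen when following its border from the right of $\vec e$, counterclockwise if $\varepsilon_1=+$ and clockwise if $\varepsilon_1=-$. Put $\varphi((T_1,l_1),(T_2,l_2))=(T,\vec e,\varepsilon_2)$. *Separation $\psi$.* Let $T$ be a balanced eulerian tree with a marked oriented inner edge $\vec e$ and a sign $\varepsilon$. Let $\varepsilon'=+$ if the first free leaf of $T$ seen when following its border counterclockwise from the right of $\vec e$ is the root, and $\varepsilon'=-$ otherwise. Cut $\vec e$ and put a marked black leaf at each end of the cut; let $T_1$, with marked leaf $l_1$, be the part containing the origin of $\vec e$, and $T_2$, with marked leaf $l_2$,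 the other part. Root $T_1$ with sign $\varepsilon'$ from $l_1$ and $T_2$ with sign $\varepsilon$ from $l_2$. Put $\psi(T,\vec e,\varepsilon)=((T_1,l_1),(T_2,l_2))$. **Proposition.** For every $\mathbf d$ (and for either convention on the rerooting sign), let $X(\mathbf d)$ be the set of pairs $((T_1,l_1),(T_2,l_2))$ of balanced eulerian trees with a marked black leaf each, whose degree distributions $\mathbf s$ and $\mathbf t$ satisfy $\mathbf s+\mathbf t=\mathbf d$, and let $Y(\mathbf d)$ be the set of triples $(T,\vec e,\varepsilon)$ where $T$ is a balanced eulerian tree with degree distribution $\mathbf d$, $\vec e$ is a marked oriented inner edge of $T$ and $\varepsilon\in\{+,-\}$. Then $\varphi$ is a bijection from $X(\mathbf d)$ onto $Y(\mathbf d)$, $\psi$ is a bijection from $Y(\mathbf d)$ onto $X(\mathbf d)$, and $\varphi$ and $\psi$ are inverse of each other. -/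

import Mathlib

namespace EulerianTrees

/-- The colour of a leaf. -/
inductive Color
  | black
  | white
deriving DecidableEq

/-- A sign. -/
inductive Sgn
  | plus
  | minus
deriving DecidableEq

/-- A plane tree rooted on a leaf, up to orientation preserving homeomorphism of the sphere.
The root leaf itself is not written down (it is always black): a `PlaneTree` is what hangs at the
other end of the edge of the root leaf. The list of children of an inner vertex `v` is the list of
the neighbours of `v` in counterclockwise order around `v`, starting just after the neighbour
through which `v` is reached from the root leaf. -/
inductive PlaneTree
  | leaf (c : Color)
  | node (children : List PlaneTree)

namespace PlaneTree

/-- Is this (the top of) the tree a white leaf? -/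
def isWhiteLeaf : PlaneTree → Bool
  | leaf Color.white => true
  | _ => false

/-- Is this (the top of) the tree an inner vertex? -/
def isInner : PlaneTree → Bool
  | leaf _ => false
  | node _ => true

/-- All inner vertices of the tree, each one given by the list of its children. -/
def innerVertices : PlaneTree → List (List PlaneTree)
  | leaf _ => []
  | node ts => ts :: ts.flatMap innerVertices

/-- The colours of the leaves other than the root leaf, in the order in which they are seen when
following the border of the tree counterclockwise from the root leaf. -/
def leafColors : PlaneTree → List Color
  | leaf c => [c]
  | node ts => ts.flatMap leafColors

/-- The word of the tree: the border is followed counterclockwise, ending at the root leaf. -/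
def word (T : PlaneTree) : List Color := T.leafColors ++ [Color.black]

/-- Eulerian trees: there is an inner vertex, and each inner vertex has even degree `2 * i` and
is adjacent to exactly `i - 1` white leaves. The neighbours of an inner vertex are its children
and one more vertex, which is another inner vertex or the root leaf, hence not a white leaf. -/
def IsEulerian (T : PlaneTree) : Prop :=
  T.isInner ∧ ∀ ts ∈ T.innerVertices, ∃ i : ℕ,
    ts.length + 1 = 2 * i ∧ ts.countP isWhiteLeaf + 1 = i

/-- The tree has exactly `d i` inner vertices of degree `2 * i`, for each `i ≥ 1`. -/
def HasDegreeDistribution (T : PlaneTree) (d : ℕ+ →₀ ℕ) : Prop :=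
  ∀ i : ℕ+, T.innerVertices.countP (fun ts => ts.length + 1 = 2 * (i : ℕ)) = d i

/-- Correct bracketing words: `white` is the opening bracket and `black` the closing one. -/
def IsCorrect (p : List Color) : Prop :=
  (∀ u : List Color, u <+: p → u.count Color.black ≤ u.count Color.white) ∧
    p.count Color.black = p.count Color.white

/-- The word of the tree is `p₁ b p₂ b` with `p₁`, `p₂` correct: the root leaf is a free leaf. -/
def IsBalanced (T : PlaneTree) : Prop :=
  ∃ p₁ p₂ : List Color, IsCorrect p₁ ∧ IsCorrect p₂ ∧
    T.word = p₁ ++ [Color.black] ++ p₂ ++ [Color.black]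

/-- A place in a tree, described by the path that leads to it from the root leaf: for each inner
vertex met along the path, the children before and the children after the one where the path goes
on. The empty path is the place of the vertex adjacent to the root leaf. -/
abbrev Path := List (List PlaneTree × List PlaneTree)

/-- The tree which has `S` at the end of the path. -/
def plug : Path → PlaneTree → PlaneTree
  | [], S => S
  | (l, r) :: C, S => node (l ++ plug C S :: r)

/-- The same path followed in the opposite direction. For a leaf at the end of the path `C` in a
tree `T`, the tree `plug (turn C) (leaf black)` is `T` rooted at that leaf, with the former root
leaf (now an ordinary black leaf) at the end of the path `turn C`. -/
def turn (C : Path) : Path := (C.map Prod.swap).reverse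

/-- The paths to the black leaves other than the root leaf, in the order in which they are seen
when following the border of the tree counterclockwise from the root leaf. -/
def blackLeaves : PlaneTree → List Path
  | leaf Color.black => [[]]
  | leaf Color.white => []
  | node ts => (List.finRange ts.length).flatMap fun i =>
      (blackLeaves (ts.get i)).map fun C => (ts.take i, ts.drop (i + 1)) :: C
decreasing_by
  have := List.sizeOf_get ts i
  simp only [node.sizeOf_spec]
  omega

/-- A tree with a marked leaf: `none` marks the root leaf, `some C` the end of the path `C`. -/
structure LeafMarked where
  tree : PlaneTree
  mark : Option Path

/-- The mark is on a black leaf of the tree. -/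
def LeafMarked.IsMarkedTree (x : LeafMarked) : Prop :=
  ∀ C : Path, x.mark = some C → plug C (leaf Color.black) = x.tree

/-- Exchange the root leaf and the marked leaf: the same unrooted tree, now rooted at the leaf
that was marked, with a mark on the former root leaf. -/
def LeafMarked.exchange (x : LeafMarked) : LeafMarked :=
  match x.mark with
  | none => x
  | some C => ⟨plug (turn C) (leaf Color.black), some (turn C)⟩

/-- The leaf `l` of `T` is a free leaf: the tree is balanced when it is rooted there. -/
def IsFree (T : PlaneTree) (l : Option Path) : Prop :=
  (LeafMarked.exchange ⟨T, l⟩).tree.IsBalanced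

open Classical in
/-- The free leaves of `A` in the order in which they are encountered when following the border
clockwise, starting from the root leaf of `A`. The root leaf itself comes first if `countStart`
is `true` (the walk starts on it) and last otherwise (the walk comes back to it at the end). -/
noncomputable def freeClockwise (countStart : Bool) (A : PlaneTree) : List (Option Path) :=
  (if countStart then none :: A.blackLeaves.reverse.map some
    else A.blackLeaves.reverse.map some ++ [none]).filter fun l => IsFree A l

open Classical in
/-- The rerooting sign of a balanced tree with a marked black leaf: `+` if the root is the first
free leaf encountered when following the border clockwise from the marked leaf, `-` otherwise. -/
noncomputable def LeafMarked.sign (countStart : Bool) (x : LeafMarked) : Sgn :=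
  if (freeClockwise countStart x.exchange.tree).head? = some x.exchange.mark
  then Sgn.plus else Sgn.minus

/-- From a tree `A` rooted at a black leaf `l` and a sign, the same tree with a mark on `l` and
rooted at a free leaf: the first one encountered clockwise from `l` if the sign is `+`, the other
one if it is `-`. (The default value of `getD` is never used for an eulerian tree.) -/
noncomputable def unreroot (countStart : Bool) (A : PlaneTree) : Sgn → LeafMarked
  | Sgn.plus => LeafMarked.exchange ⟨A, (freeClockwise countStart A).getD 0 none⟩
  | Sgn.minus => LeafMarked.exchange ⟨A, (freeClockwise countStart A).getD 1 none⟩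

/-- An orientation of an edge of a rooted tree: away from the root leaf or towards it. -/
inductive Direction
  | away
  | towards
deriving DecidableEq

/-- A tree with a marked oriented edge. The marked edge joins the end of `path`, where the subtree
`below` hangs, to the last vertex met before it. -/
structure EdgeMarked where
  path : Path
  below : PlaneTree
  direction : Direction

/-- The tree that carries the marked edge. -/
def EdgeMarked.tree (y : EdgeMarked) : PlaneTree := plug y.path y.below

/-- The marked edge is an inner edge: both ends are inner vertices. -/
def EdgeMarked.IsInnerEdge (y : EdgeMarked) : Prop := y.path ≠ [] ∧ y.below.isInner

/-- An unrooted tree with a marked oriented edge `e`, cut along `e`: `source` is the part that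
contains the origin of `e` and `target` the other part, each one rooted at its end of the cut. -/
structure Halves where
  source : PlaneTree
  target : PlaneTree

/-- The black leaves of the whole tree in the order in which they are seen when following its
border counterclockwise, starting at the right of the oriented edge: `inl C` is a leaf of the
source part, `inr C` a leaf of the target part. -/
def Halves.border (H : Halves) : List (Path ⊕ Path) :=
  H.target.blackLeaves.map Sum.inr ++ H.source.blackLeaves.map Sum.inl

/-- Put the two halves together and root the resulting tree at the given leaf. -/
def Halves.rootAt (H : Halves) : Path ⊕ Path → EdgeMarked
  | Sum.inl C => ⟨turn C, H.target, Direction.away⟩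
  | Sum.inr C => ⟨turn C, H.source, Direction.towards⟩

open Classical in
/-- The free leaves of the whole tree, in the order of `Halves.border`. -/
noncomputable def Halves.freeLeaves (H : Halves) : List (Path ⊕ Path) :=
  H.border.filter fun l => (H.rootAt l).tree.IsBalanced

/-- Cut the marked edge and put a black leaf at each end. -/
def EdgeMarked.halves (y : EdgeMarked) : Halves :=
  match y.direction with
  | Direction.away => ⟨plug (turn y.path) (leaf Color.black), y.below⟩
  | Direction.towards => ⟨y.below, plug (turn y.path) (leaf Color.black)⟩

/-- The place of the root leaf of the tree after the marked edge has been cut. -/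
def EdgeMarked.rootLeaf (y : EdgeMarked) : Path ⊕ Path :=
  match y.direction with
  | Direction.away => Sum.inl (turn y.path)
  | Direction.towards => Sum.inr (turn y.path)

/-- The merging `φ`: the two marked leaves are merged into an edge, oriented from the first tree to
the second. The result is rooted at the first free leaf seen from the right of that edge,
counterclockwise if the rerooting sign of the first tree is `+` and clockwise otherwise, and the
rerooting sign of the second tree is kept. (The default of `headD` is never used for eulerian
trees.) -/
noncomputable def merge (countStart : Bool) (x : LeafMarked × LeafMarked) : EdgeMarked × Sgn :=
  let H : Halves := ⟨x.1.exchange.tree, x.2.exchange.tree⟩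
  let root := match x.1.sign countStart with
    | Sgn.plus => H.freeLeaves.headD (Sum.inl [])
    | Sgn.minus => H.freeLeaves.reverse.headD (Sum.inl [])
  (H.rootAt root, x.2.sign countStart)

open Classical in
/-- The separation `ψ`: the marked edge is cut, with a marked black leaf at each end. The sign used
to root the first tree is `+` if the root is the first free leaf seen counterclockwise from the
right of the marked edge, `-` otherwise; the second tree is rooted with the given sign. -/
noncomputable def separate (countStart : Bool) (y : EdgeMarked × Sgn) : LeafMarked × LeafMarked :=
  let H := y.1.halves
  let sign₁ := if H.freeLeaves.head? = some y.1.rootLeaf then Sgn.plus else Sgn.minus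
  (unreroot countStart H.source sign₁, unreroot countStart H.target y.2)

/-- Balanced eulerian trees with degree distribution `d`. -/
def balancedTrees (d : ℕ+ →₀ ℕ) : Set PlaneTree :=
  {T | T.IsEulerian ∧ T.IsBalanced ∧ T.HasDegreeDistribution d}

/-- Pairs of balanced eulerian trees, each with a marked black leaf, with degree distributions
`s` and `t` such that `s + t = d`. -/
def leafMarkedPairs (d : ℕ+ →₀ ℕ) : Set (LeafMarked × LeafMarked) :=
  {x | x.1.IsMarkedTree ∧ x.2.IsMarkedTree ∧ ∃ s t : ℕ+ →₀ ℕ, s + t = d ∧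
    x.1.tree ∈ balancedTrees s ∧ x.2.tree ∈ balancedTrees t}

/-- Balanced eulerian trees with degree distribution `d`, with a marked oriented inner edge and a
sign. -/
def edgeMarkedTrees (d : ℕ+ →₀ ℕ) : Set (EdgeMarked × Sgn) :=
  {y | y.1.IsInnerEdge ∧ y.1.tree ∈ balancedTrees d}

end PlaneTree

end EulerianTrees

/-!
Let `A` be a balanced eulerian tree rerooted at its marked leaf. The tree and the mark are recovered
from `A` together with the former root, which is one of the free leaves of `A`. As there are exactly
two free leaves, the rerooting sign encodes this choice, and marked balanced trees correspond to
pairs `(A, ε)` (`unreroot_sign`, `exchange_unreroot`, `sign_unreroot`).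

In the same way, a balanced eulerian tree with a marked oriented inner edge is given by the two
halves of the cut tree, rooted at the ends of the cut, and by the root, which is one of the two free
leaves of the whole tree (`rootAt_rootLeaf`, `halves_rootAt`); so it corresponds to a triple
`(A₁, A₂, ε)`. Merging sends `((A₁, ε₁), (A₂, ε₂))` to `((A₁, A₂, ε₁), ε₂)` and separation is the same
correspondence read backwards.

The number of free leaves comes from the cycle lemma (`filter_blackSplits`): a cyclic word with two
more black letters than white ones has exactly two black letters after which it can be cut to give
a balanced word. It applies to an eulerian tree (`exists_freeClockwise_eq`) and to the merging of
two of them (`exists_freeLeaves_eq`), since counting leaves at each vertex gives the surplus of black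
leaves (`height_leafColors`). The vertices, with their degrees and numbers of white leaves, do not
depend on the root (`vertexTypes_plug`, `pathVertexTypes_turn`), so that being eulerian and the
degree distribution are preserved.
-/

namespace EulerianTrees

namespace PlaneTree

open Color

/-! ### Heights of words and the cycle lemma -/

/-- The number of white letters minus the number of black letters. -/
def height (u : List Color) : ℤ := u.count white - u.count black

@[simp] lemma height_nil : height [] = 0 := by simp [height]

@[simp] lemma height_cons_black (u : List Color) : height (black :: u) = height u - 1 := by
  simp [height]; ring

@[simp] lemma height_cons_white (u : List Color) : height (white :: u) = height u + 1 := by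
  simp [height]; ring

@[simp] lemma height_append (u v : List Color) : height (u ++ v) = height u + height v := by
  simp [height]; ring

lemma isCorrect_iff_height (p : List Color) :
    IsCorrect p ↔ (∀ u, u <+: p → 0 ≤ height u) ∧ height p = 0 := by
  unfold IsCorrect height
  refine and_congr (forall₂_congr fun u _ => ?_) ?_ <;> omega

lemma prefix_append_cases {u p q : List Color} (h : u <+: p ++ q) :
    u <+: p ∨ ∃ t, u = p ++ t ∧ t <+: q := by
  obtain ⟨v, h⟩ := h
  rcases List.append_eq_append_iff.1 h with ⟨a, rfl, rfl⟩ | ⟨a, rfl, rfl⟩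
  · exact Or.inl ⟨a, rfl⟩
  · exact Or.inr ⟨a, rfl, ⟨v, rfl⟩⟩

/-- The words `p₁ b p₂ b` with `p₁`, `p₂` correct. -/
def IsBalancedWord (y : List Color) : Prop :=
  ∃ p₁ p₂ : List Color, IsCorrect p₁ ∧ IsCorrect p₂ ∧ y = p₁ ++ [black] ++ p₂ ++ [black]

/-- A balanced word has height `-2` and its proper prefixes have height at least `-1`, so its
nonempty suffixes have negative height. -/
lemma IsBalancedWord.height_suffix_neg {y s : List Color}
    (h : IsBalancedWord (y ++ (s ++ [black]))) : height (s ++ [black]) < 0 := by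
  obtain ⟨p₁, p₂, h₁, h₂, e⟩ := h
  rw [isCorrect_iff_height] at h₁ h₂
  rw [← List.append_assoc] at e
  replace e := List.append_cancel_right e
  have hy : -1 ≤ height y := by
    have hp : y <+: (p₁ ++ [black]) ++ p₂ := ⟨s, e⟩
    rcases prefix_append_cases hp with hp | ⟨t, rfl, ht⟩
    · rcases List.prefix_concat_iff.1 hp with rfl | hp
      · simp [h₁.2]
      · have := h₁.1 _ hp
        omega
    · have := h₂.1 _ ht
      simp [h₁.2]
      omega
  have := congrArg height e
  simp [h₁.2, h₂.2] at this ⊢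
  omega

/-- Cutting a word just before it first goes below the height `L`. -/
lemma exists_first_descent (x : List Color) (L : ℤ) (hL : L ≤ 0)
    (h : ∃ u, u <+: x ∧ height u < L) :
    ∃ p r, x = p ++ black :: r ∧ height p = L ∧ ∀ u, u <+: p → L ≤ height u := by
  induction x generalizing L with
  | nil =>
    obtain ⟨u, hu, h⟩ := h
    obtain rfl := List.prefix_nil.1 hu
    simp at h; omega
  | cons c x ih =>
    by_cases hc : c = black ∧ L = 0
    · obtain ⟨rfl, rfl⟩ := hc
      exact ⟨[], x, rfl, by simp, fun u hu => by simp [List.prefix_nil.1 hu]⟩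
    · have step : ∀ e : ℤ, (∀ u, height (c :: u) = height u + e) → L - e ≤ 0 →
          ∃ p r, c :: x = p ++ black :: r ∧ height p = L ∧ ∀ u, u <+: p → L ≤ height u := by
        intro e he hle
        obtain ⟨p, r, rfl, hp, hpre⟩ := ih (L - e) hle (by
          obtain ⟨u, hu, h⟩ := h
          rcases List.prefix_cons_iff.1 hu with rfl | ⟨t, rfl, ht⟩
          · simp at h; omega
          · refine ⟨t, ht, ?_⟩
            rw [he] at h; omega)
        refine ⟨c :: p, r, rfl, by rw [he]; omega, fun u hu => ?_⟩
        rcases List.prefix_cons_iff.1 hu with rfl | ⟨t, rfl, ht⟩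
        · simpa using hL
        · have := hpre t ht
          rw [he]; omega
      cases c with
      | black => exact step (-1) (fun u => by simp; ring) (by simp at hc; omega)
      | white => exact step 1 (fun u => by simp) (by omega)

/-- If `m` is the minimal height of the prefixes of `w`, the two distinguished black letters are
those where the heights `m + 1` and `m` are first reached. -/
lemma exists_cyclic_decomposition (w : List Color) (hw : height w = -2) :
    ∃ p q r, w = p ++ black :: (q ++ black :: r) ∧ IsCorrect q ∧ IsCorrect (r ++ p) := by
  obtain ⟨v, hv, hmin⟩ := Finset.exists_min_image w.inits.toFinset height ⟨[], by simp⟩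
  simp only [List.mem_toFinset, List.mem_inits] at hv hmin
  have hm : height v ≤ -2 := hw ▸ hmin w (List.prefix_refl w)
  obtain ⟨p, r', rfl, hp, hpre⟩ := exists_first_descent w (height v + 2) (by omega)
    ⟨v, hv, by omega⟩
  have hr' : ∀ u, u <+: r' → -1 ≤ height u := by
    intro u hu
    have := hmin (p ++ black :: u) ((List.prefix_append_right_inj p).2
      ((List.prefix_cons_inj black).2 hu))
    simp at this; omega
  obtain ⟨q, r, rfl, hq, hqpre⟩ := exists_first_descent r' 0 le_rfl (by
    rcases prefix_append_cases hv with h | ⟨t, rfl, ht⟩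
    · have := hpre v h; omega
    · rcases List.prefix_cons_iff.1 ht with rfl | ⟨s, rfl, hs⟩
      · simp at hp
      · refine ⟨s, hs, ?_⟩
        simp at hp; omega)
  refine ⟨p, q, r, rfl, (isCorrect_iff_height q).2 ⟨hqpre, hq⟩, (isCorrect_iff_height _).2 ?_⟩
  simp at hw
  refine ⟨fun u hu => ?_, by simp; omega⟩
  rcases prefix_append_cases hu with h | ⟨t, rfl, ht⟩
  · have := hr' (q ++ black :: u) ((List.prefix_append_right_inj q).2
      ((List.prefix_cons_inj black).2 h))
    simp at this; omega
  · have := hpre t ht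
    simp; omega

/-- The ways to write a word as `u b v`, from left to right, as the list of the pairs `(u, v)`. -/
def blackSplits : List Color → List (List Color × List Color)
  | [] => []
  | black :: w => ([], w) :: (blackSplits w).map fun s => (black :: s.1, s.2)
  | white :: w => (blackSplits w).map fun s => (white :: s.1, s.2)

lemma blackSplits_append (x y : List Color) :
    blackSplits (x ++ y) = (blackSplits x).map (fun s => (s.1, s.2 ++ y)) ++
      (blackSplits y).map fun s => (x ++ s.1, s.2) := by
  induction x with
  | nil => simp [blackSplits]
  | cons c x ih => cases c <;> simp [blackSplits, ih, Function.comp_def]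

lemma eq_of_mem_blackSplits {w : List Color} {s : List Color × List Color}
    (h : s ∈ blackSplits w) : w = s.1 ++ black :: s.2 := by
  induction w generalizing s with
  | nil => simp [blackSplits] at h
  | cons c w ih =>
    cases c <;> simp only [blackSplits, List.mem_cons, List.mem_map] at h
    · rcases h with rfl | ⟨t, ht, rfl⟩
      · rfl
      · simpa using ih ht
    · obtain ⟨t, ht, rfl⟩ := h
      simpa using ih ht

lemma nodup_blackSplits (w : List Color) : (blackSplits w).Nodup := by
  have hinj : ∀ c : Color, Function.Injective
      fun s : List Color × List Color => (c :: s.1, s.2) := by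
    rintro c ⟨a, b⟩ ⟨a', b'⟩ h
    simpa using h
  induction w with
  | nil => simp [blackSplits]
  | cons c w ih =>
    cases c
    · exact List.nodup_cons.2 ⟨by simp, ih.map (hinj _)⟩
    · exact ih.map (hinj _)

open Classical in
/-- The cycle lemma: a cyclic word of height `-2` has exactly two black letters such that the
linear word that ends with this letter is balanced. -/
lemma filter_blackSplits (w : List Color) (hw : height w = -2) :
    ∃ s t, (blackSplits w).filter (fun s => IsBalancedWord (s.2 ++ s.1 ++ [black])) = [s, t] := by
  obtain ⟨p, q, r, rfl, hq, hrp⟩ := exists_cyclic_decomposition w hw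
  have hq' := ((isCorrect_iff_height q).1 hq).1
  have hrp' := ((isCorrect_iff_height _).1 hrp).1
  refine ⟨(p, q ++ black :: r), (p ++ black :: q, r), ?_⟩
  have h₁ : IsBalancedWord (q ++ black :: (r ++ (p ++ [black]))) := ⟨q, r ++ p, hq, hrp, by simp⟩
  have h₂ : IsBalancedWord (r ++ (p ++ black :: (q ++ [black]))) := ⟨r ++ p, q, hrp, hq, by simp⟩
  -- A black letter inside `p`, `q` or `r` is matched, so the linear word that ends with it has
  -- a suffix of nonnegative height.
  have key : ∀ (x y z : List Color), 0 ≤ height (z ++ [black]) → x = y ++ (z ++ [black]) →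
      ¬ IsBalancedWord x := by
    rintro x y z hz rfl h
    have := h.height_suffix_neg
    omega
  have hP : ∀ s ∈ blackSplits p,
      ¬ IsBalancedWord (s.2 ++ black :: (q ++ black :: (r ++ (s.1 ++ [black])))) := by
    intro s hs
    have e := eq_of_mem_blackSplits hs
    exact key _ (s.2 ++ black :: (q ++ [black])) (r ++ s.1)
      (hrp' _ ⟨s.2, by rw [e]; simp⟩) (by simp)
  have hQ : ∀ s ∈ blackSplits q,
      ¬ IsBalancedWord (s.2 ++ black :: (r ++ (p ++ black :: (s.1 ++ [black])))) := by
    intro s hs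
    have e := eq_of_mem_blackSplits hs
    exact key _ (s.2 ++ black :: (r ++ (p ++ [black]))) s.1
      (hq' _ ⟨s.2, by rw [e]; simp⟩) (by simp)
  have hR : ∀ s ∈ blackSplits r,
      ¬ IsBalancedWord (s.2 ++ (p ++ black :: (q ++ black :: (s.1 ++ [black])))) := by
    intro s hs
    have e := eq_of_mem_blackSplits hs
    exact key _ (s.2 ++ (p ++ black :: (q ++ [black]))) s.1
      (hrp' _ ⟨s.2 ++ p, by rw [e]; simp⟩) (by simp)
  have nil_of : ∀ (l : List (List Color × List Color)) (P : List Color × List Color → Prop),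
      (∀ s ∈ l, ¬ P s) → l.filter (fun s => P s) = [] := by
    intro l P h
    simpa using h
  simp [blackSplits_append, blackSplits, List.filter_append, List.filter_map,
    Function.comp_def, h₁, h₂, nil_of _ _ hP, nil_of _ _ hQ, nil_of _ _ hR]

open Classical in
/-- The cycle lemma for a list of objects that stand for the black letters of the cyclic word. -/
lemma exists_filter_eq_pair {α : Type*} (L : List α) (g : α → List Color × List Color)
    (w : List Color) (hg : L.map g = blackSplits w) (hw : height w = -2) (P : α → Prop)
    (hP : ∀ l, P l ↔ IsBalancedWord ((g l).2 ++ (g l).1 ++ [black])) :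
    ∃ a b, a ≠ b ∧ L.filter (fun l => P l) = [a, b] := by
  obtain ⟨s, t, h⟩ := filter_blackSplits w hw
  have hnd : (L.filter fun l => P l).Nodup :=
    List.Nodup.filter _ (List.Nodup.of_map g (hg ▸ nodup_blackSplits w))
  have hlen : (L.filter fun l => P l).length = 2 := by
    rw [← hg, List.filter_map] at h
    have := congrArg List.length h
    rw [List.length_map] at this
    simpa only [Function.comp_def, ← hP, List.length_cons, List.length_nil] using this
  obtain ⟨a, b, hab⟩ := List.length_eq_two.1 hlen
  rw [hab] at hnd
  exact ⟨a, b, by simpa using hnd, hab⟩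

/-! ### Paths, leaves and rerooting -/

@[simp] lemma turn_turn (C : Path) : turn (turn C) = C := by
  simp [turn, Function.comp_def]

@[simp] lemma turn_eq_nil (C : Path) : turn C = [] ↔ C = [] := by simp [turn]

/-- The colours of the leaves on the border between the root leaf and the end of the path. -/
def colorsBefore (C : Path) : List Color := C.flatMap fun f => f.1.flatMap leafColors

/-- The colours of the leaves on the border between the end of the path and the root leaf. -/
def colorsAfter (C : Path) : List Color := C.reverse.flatMap fun f => f.2.flatMap leafColors

@[simp] lemma colorsBefore_turn (C : Path) : colorsBefore (turn C) = colorsAfter C := by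
  simp [colorsBefore, colorsAfter, turn, List.flatMap_map, ← List.map_reverse]

@[simp] lemma colorsAfter_turn (C : Path) : colorsAfter (turn C) = colorsBefore C := by
  simp [colorsBefore, colorsAfter, turn, List.flatMap_map]

lemma leafColors_plug (C : Path) (S : PlaneTree) :
    leafColors (plug C S) = colorsBefore C ++ leafColors S ++ colorsAfter C := by
  induction C with
  | nil => simp [plug, colorsBefore, colorsAfter]
  | cons f C ih =>
    obtain ⟨l, r⟩ := f
    simp only [colorsBefore, colorsAfter] at ih
    simp [plug, leafColors, colorsBefore, colorsAfter, ih]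

lemma blackSplits_flatMap {α : Type*} (f : α → List Color) (ts : List α) :
    blackSplits (ts.flatMap f) = (List.finRange ts.length).flatMap fun i =>
      (blackSplits (f (ts.get i))).map fun s =>
        ((ts.take i).flatMap f ++ s.1, s.2 ++ (ts.drop (i + 1)).flatMap f) := by
  induction ts with
  | nil => simp [blackSplits]
  | cons t ts ih =>
    simp [List.finRange_succ, blackSplits_append, ih, List.map_flatMap, List.flatMap_map,
      Function.comp_def]

/-- The black leaves, in the order of the border, are the black letters of the word. -/
theorem map_blackLeaves : ∀ T : PlaneTree,
    (blackLeaves T).map (fun C => (colorsBefore C, colorsAfter C)) = blackSplits (leafColors T)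
  | leaf black => by simp [blackLeaves, leafColors, blackSplits, colorsBefore, colorsAfter]
  | leaf white => by simp [blackLeaves, leafColors, blackSplits]
  | node ts => by
    rw [blackLeaves, leafColors, blackSplits_flatMap, List.map_flatMap]
    refine List.flatMap_congr fun i _ => ?_
    rw [← map_blackLeaves (ts.get i)]
    simp [colorsBefore, colorsAfter]
decreasing_by
  have := List.sizeOf_get ts i
  simp only [node.sizeOf_spec]
  omega

lemma mem_blackLeaves (C : Path) (T : PlaneTree) :
    C ∈ blackLeaves T ↔ plug C (leaf black) = T := by
  induction C generalizing T with
  | nil =>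
    rcases T with (_ | _) | ts <;> simp [blackLeaves, plug]
  | cons f C ih =>
    obtain ⟨l, r⟩ := f
    rcases T with (_ | _) | ts
    · simp [blackLeaves, plug]
    · simp [blackLeaves, plug]
    · simp only [blackLeaves, List.mem_flatMap, List.mem_finRange, true_and, List.mem_map,
        List.cons.injEq, Prod.mk.injEq, plug, node.injEq]
      constructor
      · rintro ⟨i, _, h, ⟨rfl, rfl⟩, rfl⟩
        rw [(ih _).1 h]
        simp
      · rintro rfl
        exact ⟨⟨l.length, by simp⟩, C, by simp [ih], ⟨by simp, by simp⟩, rfl⟩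

lemma exchange_exchange {x : LeafMarked} (hx : x.IsMarkedTree) : x.exchange.exchange = x := by
  obtain ⟨T, _ | C⟩ := x
  · rfl
  · have : plug C (leaf black) = T := hx C rfl
    simp [LeafMarked.exchange, this]

lemma isMarkedTree_exchange (x : LeafMarked) : x.exchange.IsMarkedTree := by
  obtain ⟨T, _ | C⟩ := x
  · rintro C ⟨⟩
  · rintro _ ⟨⟩
    rfl

/-! ### Vertices, degrees and leaves of eulerian trees -/

/-- The list, over all inner vertices, of the number of children and the number of children that
are white leaves. Up to order, it does not depend on the choice of the root leaf. -/
def vertexTypes (T : PlaneTree) : List (ℕ × ℕ) :=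
  T.innerVertices.map fun ts => (ts.length, ts.countP isWhiteLeaf)

/-- The contribution to `vertexTypes` of all vertices of `plug C S` outside `S`, if `S` is not a
white leaf. -/
def pathVertexTypes (C : Path) : List (ℕ × ℕ) :=
  C.flatMap fun f => (f.1.length + f.2.length + 1,
    f.1.countP isWhiteLeaf + f.2.countP isWhiteLeaf) ::
      (f.1.flatMap vertexTypes ++ f.2.flatMap vertexTypes)

lemma vertexTypes_node (ts : List PlaneTree) :
    vertexTypes (node ts) =
      (ts.length, ts.countP isWhiteLeaf) :: ts.flatMap vertexTypes := by
  simp [vertexTypes, innerVertices, List.map_flatMap]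
  rfl

@[simp] lemma vertexTypes_leaf (c : Color) : vertexTypes (leaf c) = [] := by
  simp [vertexTypes, innerVertices]

lemma isWhiteLeaf_plug (C : Path) {S : PlaneTree} (hS : S.isWhiteLeaf = false) :
    (plug C S).isWhiteLeaf = false := by
  cases C with
  | nil => exact hS
  | cons f C => rfl

lemma vertexTypes_plug (C : Path) {S : PlaneTree} (hS : S.isWhiteLeaf = false) :
    (vertexTypes (plug C S)).Perm (pathVertexTypes C ++ vertexTypes S) := by
  induction C with
  | nil => simp [plug, pathVertexTypes]
  | cons f C ih =>
    obtain ⟨l, r⟩ := f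
    simp only [plug, vertexTypes_node, pathVertexTypes, List.flatMap_cons, List.flatMap_append,
      List.length_append, List.length_cons, List.countP_append, List.countP_cons,
      isWhiteLeaf_plug C hS, List.cons_append, List.append_assoc]
    simp only [Bool.false_eq_true, if_false, Nat.add_zero, ← Nat.add_assoc]
    refine (List.Perm.append_left _ ?_).cons _
    exact (List.perm_append_comm).trans (List.Perm.append_left _ ih)

lemma pathVertexTypes_turn (C : Path) : (pathVertexTypes (turn C)).Perm (pathVertexTypes C) := by
  unfold pathVertexTypes turn
  refine ((List.reverse_perm _).flatMap_right _).trans ?_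
  rw [List.flatMap_map]
  refine List.Perm.flatMap_left _ fun f _ => ?_
  simp only [Prod.fst_swap, Prod.snd_swap]
  rw [Nat.add_comm f.2.length, Nat.add_comm (f.2.countP _)]
  exact List.Perm.cons _ List.perm_append_comm

/-- The condition on an inner vertex of an eulerian tree, for its number of children and its number
of white leaves. -/
def IsEulerianType (a : ℕ × ℕ) : Prop := ∃ i : ℕ, a.1 + 1 = 2 * i ∧ a.2 + 1 = i

lemma isEulerian_iff (T : PlaneTree) :
    T.IsEulerian ↔ T.isInner ∧ ∀ a ∈ T.vertexTypes, IsEulerianType a := by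
  simp [IsEulerian, vertexTypes, IsEulerianType]

lemma hasDegreeDistribution_iff (T : PlaneTree) (d : ℕ+ →₀ ℕ) :
    T.HasDegreeDistribution d ↔
      ∀ i : ℕ+, T.vertexTypes.countP (fun a => a.1 + 1 = 2 * (i : ℕ)) = d i := by
  simp [HasDegreeDistribution, vertexTypes, List.countP_map, Function.comp_def]

/-- The subtrees of an eulerian tree other than the white leaves have one more black leaf than
white ones: at an inner vertex with `2 * i - 1` children, `i - 1` of them contribute a surplus
of one white leaf and the other `i` a surplus of one black leaf. -/
theorem height_leafColors : ∀ T : PlaneTree, (∀ a ∈ T.vertexTypes, IsEulerianType a) →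
    height T.leafColors = if T.isWhiteLeaf then 1 else -1
  | leaf black, _ => by simp [leafColors, isWhiteLeaf]
  | leaf white, _ => by simp [leafColors, isWhiteLeaf]
  | node ts, h => by
    rw [vertexTypes_node] at h
    have hc : ∀ us : List PlaneTree, us ⊆ ts → height (us.flatMap leafColors) =
        2 * (us.countP isWhiteLeaf : ℤ) - us.length := by
      intro us
      induction us with
      | nil => simp
      | cons u us ih =>
        intro hus
        have hu : u ∈ ts := hus (by simp)
        have := height_leafColors u fun a ha =>
          h a (List.mem_cons_of_mem _ (List.mem_flatMap.2 ⟨u, hu, ha⟩))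
        rw [List.flatMap_cons, height_append, ih (fun v hv => hus (by simp [hv])), this,
          List.countP_cons, List.length_cons]
        split_ifs <;> push_cast <;> ring
    obtain ⟨i, h₁, h₂⟩ := h _ List.mem_cons_self
    rw [leafColors, hc ts (List.Subset.refl _)]
    simp only [isWhiteLeaf, Bool.false_eq_true, if_false]
    simp only at h₁ h₂
    omega
decreasing_by
  have := List.sizeOf_lt_of_mem hu
  simp only [node.sizeOf_spec]
  omega

lemma isWhiteLeaf_of_isInner {T : PlaneTree} (h : T.isInner) : T.isWhiteLeaf = false := by
  cases T <;> simp_all [isInner, isWhiteLeaf]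

lemma IsEulerian.height_eq {T : PlaneTree} (h : T.IsEulerian) : height T.leafColors = -1 := by
  rw [isEulerian_iff] at h
  simp [height_leafColors T h.2, isWhiteLeaf_of_isInner h.1]

lemma isInner_plug_leaf (C : Path) (c : Color) : (plug C (leaf c)).isInner ↔ C ≠ [] := by
  cases C <;> simp [plug, isInner]

lemma isInner_plug (C : Path) {S : PlaneTree} (h : S.isInner) : (plug C S).isInner := by
  cases C with
  | nil => exact h
  | cons f C => rfl

lemma vertexTypes_plug_turn_leaf (C : Path) :
    (vertexTypes (plug (turn C) (leaf black))).Perm (vertexTypes (plug C (leaf black))) :=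
  (vertexTypes_plug _ rfl).trans
    (((pathVertexTypes_turn C).append_right _).trans (vertexTypes_plug _ rfl).symm)

lemma vertexTypes_exchange {x : LeafMarked} (hx : x.IsMarkedTree) :
    (vertexTypes x.exchange.tree).Perm (vertexTypes x.tree) := by
  obtain ⟨T, _ | C⟩ := x
  · exact List.Perm.refl _
  · obtain rfl : plug C (leaf black) = T := hx C rfl
    exact vertexTypes_plug_turn_leaf C

lemma isEulerian_exchange {x : LeafMarked} (hx : x.IsMarkedTree) (h : x.tree.IsEulerian) :
    x.exchange.tree.IsEulerian := by
  rw [isEulerian_iff] at h ⊢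
  refine ⟨?_, fun a ha => h.2 a ((vertexTypes_exchange hx).mem_iff.1 ha)⟩
  obtain ⟨T, _ | C⟩ := x
  · exact h.1
  · obtain rfl : plug C (leaf black) = T := hx C rfl
    have := h.1
    simp only [LeafMarked.exchange, isInner_plug_leaf] at this ⊢
    simpa using this

lemma hasDegreeDistribution_exchange {x : LeafMarked} (hx : x.IsMarkedTree) {d : ℕ+ →₀ ℕ}
    (h : x.tree.HasDegreeDistribution d) : x.exchange.tree.HasDegreeDistribution d := by
  rw [hasDegreeDistribution_iff] at h ⊢
  exact fun i => ((vertexTypes_exchange hx).countP_eq _).trans (h i)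

lemma isEulerian_plug_iff {C : Path} {S : PlaneTree} (hC : C ≠ []) (hS : S.isInner) :
    (plug C S).IsEulerian ↔ (plug (turn C) (leaf black)).IsEulerian ∧ S.IsEulerian := by
  have h₁ := vertexTypes_plug C (isWhiteLeaf_of_isInner hS)
  have h₂ := (vertexTypes_plug (S := leaf black) (turn C) rfl).trans
    ((pathVertexTypes_turn C).append_right _)
  simp only [isEulerian_iff, h₁.mem_iff, h₂.mem_iff, isInner_plug C hS, isInner_plug_leaf, hS]
  simp [or_imp, forall_and, hC]

lemma countP_vertexTypes_plug (C : Path) {S : PlaneTree} (hS : S.isInner)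
    (p : ℕ × ℕ → Bool) : (plug C S).vertexTypes.countP p =
      (plug (turn C) (leaf black)).vertexTypes.countP p + S.vertexTypes.countP p := by
  rw [(vertexTypes_plug C (isWhiteLeaf_of_isInner hS)).countP_eq,
    (vertexTypes_plug (S := leaf black) (turn C) rfl).countP_eq, List.countP_append,
    List.countP_append, (pathVertexTypes_turn C).countP_eq]
  simp

lemma isBalanced_plug (C : Path) (S : PlaneTree) : (plug C S).IsBalanced ↔
    IsBalancedWord (colorsBefore C ++ leafColors S ++ colorsAfter C ++ [black]) := by
  rw [← leafColors_plug]
  rfl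

/-! ### Rerooting at a free leaf -/

lemma isFree_some (A : PlaneTree) (C : Path) : IsFree A (some C) ↔
    IsBalancedWord (colorsAfter C ++ [black] ++ colorsBefore C ++ [black]) := by
  simp [IsFree, LeafMarked.exchange, isBalanced_plug, leafColors]

lemma mem_freeClockwise {b : Bool} {A : PlaneTree} {l : Option Path} :
    l ∈ freeClockwise b A ↔ (⟨A, l⟩ : LeafMarked).IsMarkedTree ∧ IsFree A l := by
  unfold freeClockwise LeafMarked.IsMarkedTree
  cases b <;> cases l <;> simp [mem_blackLeaves]

/-- An eulerian tree has exactly two free leaves. -/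
lemma exists_freeClockwise_eq (b : Bool) {A : PlaneTree} (hA : A.IsEulerian) :
    ∃ l₁ l₂, l₁ ≠ l₂ ∧ freeClockwise b A = [l₁, l₂] := by
  -- `L` lists the black leaves counterclockwise, and `w` is the word of the border.
  have main : ∀ (L : List (Option Path)) (g : Option Path → List Color × List Color)
      (w : List Color), L.map g = blackSplits w → height w = -2 →
      (∀ l, IsFree A l ↔ IsBalancedWord ((g l).2 ++ (g l).1 ++ [black])) →
      ∃ l₁ l₂, l₁ ≠ l₂ ∧
        L.reverse.filter (fun l => @decide (IsFree A l) (Classical.propDecidable _)) =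
          [l₁, l₂] := by
    intro L g w hg hw hP
    obtain ⟨a, c, hac, h⟩ := exists_filter_eq_pair L g w hg hw _ hP
    exact ⟨c, a, hac.symm, by rw [List.filter_reverse, h]; rfl⟩
  have hh := hA.height_eq
  cases b
  · convert main (none :: A.blackLeaves.map some)
      (fun l => l.elim ([], A.leafColors) fun C => (black :: colorsBefore C, colorsAfter C))
      (black :: A.leafColors) ?_ ?_ ?_ using 6
    · simp [freeClockwise]
    · simp [blackSplits, ← map_blackLeaves]
    · simp [hh]
    · rintro (_ | C)
      · simp [IsFree, LeafMarked.exchange, IsBalanced, IsBalancedWord, word]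
      · simp [isFree_some]
  · convert main (A.blackLeaves.map some ++ [none])
      (fun l => l.elim (A.leafColors, []) fun C => (colorsBefore C, colorsAfter C ++ [black]))
      (A.leafColors ++ [black]) ?_ ?_ ?_ using 6
    · simp [freeClockwise]
    · simp [blackSplits_append, blackSplits, ← map_blackLeaves]
    · simp [hh]
    · rintro (_ | C)
      · simp [IsFree, LeafMarked.exchange, IsBalanced, IsBalancedWord, word]
      · simp [isFree_some]

/-- The leaf at which `unreroot` roots the tree. -/
lemma exists_unreroot_eq (b : Bool) {A : PlaneTree} (hA : A.IsEulerian) (ε : Sgn) :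
    ∃ l ∈ freeClockwise b A, unreroot b A ε = LeafMarked.exchange ⟨A, l⟩ ∧
      (ε = Sgn.plus ↔ (freeClockwise b A).head? = some l) := by
  obtain ⟨l₁, l₂, h, e⟩ := exists_freeClockwise_eq b hA
  cases ε
  · exact ⟨l₁, by simp [e], by simp [unreroot, e], by simp [e]⟩
  · exact ⟨l₂, by simp [e], by simp [unreroot, e], by simp [e, h]⟩

lemma exchange_unreroot (b : Bool) {A : PlaneTree} (hA : A.IsEulerian) (ε : Sgn) :
    (unreroot b A ε).exchange.tree = A := by
  obtain ⟨l, hl, e, -⟩ := exists_unreroot_eq b hA ε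
  rw [e, exchange_exchange (mem_freeClockwise.1 hl).1]

lemma sign_unreroot (b : Bool) {A : PlaneTree} (hA : A.IsEulerian) (ε : Sgn) :
    (unreroot b A ε).sign b = ε := by
  obtain ⟨l, hl, e, h⟩ := exists_unreroot_eq b hA ε
  rw [e, LeafMarked.sign, exchange_exchange (mem_freeClockwise.1 hl).1]
  cases ε <;> simp_all

lemma isMarkedTree_unreroot (b : Bool) {A : PlaneTree} (hA : A.IsEulerian) (ε : Sgn) :
    (unreroot b A ε).IsMarkedTree := by
  obtain ⟨l, -, e, -⟩ := exists_unreroot_eq b hA ε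
  exact e ▸ isMarkedTree_exchange _

lemma unreroot_mem_balancedTrees (b : Bool) {A : PlaneTree} (hA : A.IsEulerian) (ε : Sgn)
    {d : ℕ+ →₀ ℕ} (hd : A.HasDegreeDistribution d) :
    (unreroot b A ε).tree ∈ balancedTrees d := by
  obtain ⟨l, hl, e, -⟩ := exists_unreroot_eq b hA ε
  obtain ⟨hm, hf⟩ := mem_freeClockwise.1 hl
  rw [e]
  exact ⟨isEulerian_exchange hm hA, hf, hasDegreeDistribution_exchange hm hd⟩

lemma mark_mem_freeClockwise (b : Bool) {x : LeafMarked} (hx : x.IsMarkedTree)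
    (hb : x.tree.IsBalanced) : x.exchange.mark ∈ freeClockwise b x.exchange.tree := by
  refine mem_freeClockwise.2 ⟨isMarkedTree_exchange x, ?_⟩
  change x.exchange.exchange.tree.IsBalanced
  rwa [exchange_exchange hx]

lemma unreroot_sign (b : Bool) {x : LeafMarked} (hx : x.IsMarkedTree) (he : x.tree.IsEulerian)
    (hb : x.tree.IsBalanced) : unreroot b x.exchange.tree (x.sign b) = x := by
  have hmem := mark_mem_freeClockwise b hx hb
  obtain ⟨l₁, l₂, h, e⟩ := exists_freeClockwise_eq b (isEulerian_exchange hx he)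
  have hex : ∀ l, l = x.exchange.mark → LeafMarked.exchange ⟨x.exchange.tree, l⟩ = x := by
    rintro _ rfl
    exact exchange_exchange hx
  rw [e] at hmem
  unfold LeafMarked.sign
  split_ifs with hs
  · rw [e] at hs
    simp only [unreroot, e]
    exact hex _ (by simpa using hs)
  · rw [e] at hs
    simp only [unreroot, e]
    refine hex _ ?_
    simp at hmem hs
    rcases hmem with h' | h'
    · exact absurd h'.symm hs
    · exact h'.symm

/-! ### Cutting and rejoining the marked edge -/

lemma isBalanced_rootAt (H : Halves) (l : Path ⊕ Path) :
    (H.rootAt l).tree.IsBalanced ↔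
      IsBalancedWord (match l with
        | Sum.inl C => colorsAfter C ++ (H.target.leafColors ++ colorsBefore C) ++ [black]
        | Sum.inr C => colorsAfter C ++ H.source.leafColors ++ colorsBefore C ++ [black]) := by
  cases l <;> simp [Halves.rootAt, EdgeMarked.tree, isBalanced_plug]

lemma mem_freeLeaves {H : Halves} {l : Path ⊕ Path} : l ∈ H.freeLeaves ↔
    (match l with
      | Sum.inl C => plug C (leaf black) = H.source
      | Sum.inr C => plug C (leaf black) = H.target) ∧ (H.rootAt l).tree.IsBalanced := by
  cases l <;> simp [Halves.freeLeaves, Halves.border, mem_blackLeaves]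

/-- Two eulerian trees joined at their root leaves have exactly two free leaves. -/
lemma exists_freeLeaves_eq {H : Halves} (h₁ : H.source.IsEulerian) (h₂ : H.target.IsEulerian) :
    ∃ l₁ l₂, l₁ ≠ l₂ ∧ H.freeLeaves = [l₁, l₂] := by
  refine exists_filter_eq_pair H.border
    (Sum.elim (fun C => (H.target.leafColors ++ colorsBefore C, colorsAfter C))
      fun C => (colorsBefore C, colorsAfter C ++ H.source.leafColors))
    (H.target.leafColors ++ H.source.leafColors) ?_ ?_ _ ?_
  · simp [Halves.border, blackSplits_append, ← map_blackLeaves, Function.comp_def]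
  · simp [h₁.height_eq, h₂.height_eq]
  · rintro (C | C) <;> simp [isBalanced_rootAt]

lemma halves_rootAt {H : Halves} {l : Path ⊕ Path} (hl : l ∈ H.freeLeaves) :
    (H.rootAt l).halves = H ∧ (H.rootAt l).rootLeaf = l := by
  have := (mem_freeLeaves.1 hl).1
  obtain ⟨S, T⟩ := H
  cases l <;> simp_all [Halves.rootAt, EdgeMarked.halves, EdgeMarked.rootLeaf]

lemma rootAt_rootLeaf (y : EdgeMarked) : y.halves.rootAt y.rootLeaf = y := by
  obtain ⟨C, S, _ | _⟩ := y <;> simp [Halves.rootAt, EdgeMarked.halves, EdgeMarked.rootLeaf]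

lemma rootLeaf_mem_freeLeaves {y : EdgeMarked} (hy : y.tree.IsBalanced) :
    y.rootLeaf ∈ y.halves.freeLeaves := by
  refine mem_freeLeaves.2 ⟨?_, by rwa [rootAt_rootLeaf]⟩
  obtain ⟨C, S, _ | _⟩ := y <;> rfl

lemma isEulerian_tree_iff {y : EdgeMarked} (hy : y.IsInnerEdge) :
    y.tree.IsEulerian ↔ y.halves.source.IsEulerian ∧ y.halves.target.IsEulerian := by
  obtain ⟨C, S, _ | _⟩ := y
  · exact isEulerian_plug_iff hy.1 hy.2
  · exact (isEulerian_plug_iff hy.1 hy.2).trans and_comm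

lemma isInnerEdge_iff (y : EdgeMarked) :
    y.IsInnerEdge ↔ y.halves.source.isInner ∧ y.halves.target.isInner := by
  obtain ⟨C, S, _ | _⟩ := y <;>
    simp [EdgeMarked.IsInnerEdge, EdgeMarked.halves, isInner_plug_leaf, and_comm]

lemma countP_vertexTypes_tree {y : EdgeMarked} (hy : y.IsInnerEdge) (p : ℕ × ℕ → Bool) :
    y.tree.vertexTypes.countP p =
      y.halves.source.vertexTypes.countP p + y.halves.target.vertexTypes.countP p := by
  obtain ⟨C, S, _ | _⟩ := y
  · exact countP_vertexTypes_plug C hy.2 p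
  · exact (countP_vertexTypes_plug C hy.2 p).trans (add_comm _ _)

lemma hasDegreeDistribution_tree_iff {y : EdgeMarked} (hy : y.IsInnerEdge) (d : ℕ+ →₀ ℕ) :
    y.tree.HasDegreeDistribution d ↔ ∃ s t : ℕ+ →₀ ℕ, s + t = d ∧
      y.halves.source.HasDegreeDistribution s ∧ y.halves.target.HasDegreeDistribution t := by
  simp only [hasDegreeDistribution_iff, countP_vertexTypes_tree hy]
  constructor
  · intro h
    -- The degrees in each half also occur in the whole tree, so the support of `d` bounds both.
    refine ⟨Finsupp.onFinset d.support (fun i => y.halves.source.vertexTypes.countP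
      fun a => a.1 + 1 = 2 * (i : ℕ)) ?_, Finsupp.onFinset d.support (fun i =>
      y.halves.target.vertexTypes.countP fun a => a.1 + 1 = 2 * (i : ℕ)) ?_, ?_, ?_, ?_⟩
    · intro i hi
      have := h i
      rw [Finsupp.mem_support_iff]; omega
    · intro i hi
      have := h i
      rw [Finsupp.mem_support_iff]; omega
    · ext i
      simpa using h i
    · intro i; rfl
    · intro i; rfl
  · rintro ⟨s, t, rfl, hs, ht⟩ i
    rw [hs, ht]; rfl

/-! ### Merging and separation -/

/-- The leaf at which `merge` roots the tree. -/
lemma exists_merge_eq (b : Bool) {x : LeafMarked × LeafMarked}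
    (h₁ : x.1.exchange.tree.IsEulerian) (h₂ : x.2.exchange.tree.IsEulerian) :
    ∃ l ∈ Halves.freeLeaves ⟨x.1.exchange.tree, x.2.exchange.tree⟩,
      merge b x = (Halves.rootAt ⟨x.1.exchange.tree, x.2.exchange.tree⟩ l, x.2.sign b) ∧
      (x.1.sign b = Sgn.plus ↔
        (Halves.freeLeaves ⟨x.1.exchange.tree, x.2.exchange.tree⟩).head? = some l) := by
  obtain ⟨l₁, l₂, h, e⟩ := exists_freeLeaves_eq (H := ⟨_, _⟩) h₁ h₂
  cases hs : x.1.sign b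
  · exact ⟨l₁, by simp [e], by simp [merge, hs, e], by simp [e]⟩
  · exact ⟨l₂, by simp [e], by simp [merge, hs, e], by simp [e, h]⟩

lemma separate_merge (b : Bool) {d : ℕ+ →₀ ℕ} {x : LeafMarked × LeafMarked}
    (hx : x ∈ leafMarkedPairs d) : separate b (merge b x) = x := by
  obtain ⟨m₁, m₂, s, t, -, ⟨e₁, b₁, -⟩, e₂, b₂, -⟩ := hx
  obtain ⟨l, hl, e, h⟩ := exists_merge_eq b (isEulerian_exchange m₁ e₁) (isEulerian_exchange m₂ e₂)
  obtain ⟨hH, hr⟩ := halves_rootAt hl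
  rw [e]
  refine Prod.ext (Eq.trans ?_ (unreroot_sign b m₁ e₁ b₁))
    (Eq.trans ?_ (unreroot_sign b m₂ e₂ b₂))
  · simp only [separate]
    split_ifs with hs <;> rw [hH, hr, ← h] at hs
    · rw [hH, hs]
    · have : x.1.sign b = Sgn.minus := by cases hc : x.1.sign b <;> simp_all
      rw [hH, this]
  · simp only [separate, hH]

lemma merge_separate (b : Bool) {d : ℕ+ →₀ ℕ} {y : EdgeMarked × Sgn}
    (hy : y ∈ edgeMarkedTrees d) : merge b (separate b y) = y := by
  obtain ⟨hi, he, hb, -⟩ := hy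
  obtain ⟨e₁, e₂⟩ := (isEulerian_tree_iff hi).1 he
  have hmem := rootLeaf_mem_freeLeaves hb
  obtain ⟨l₁, l₂, h, e⟩ := exists_freeLeaves_eq e₁ e₂
  simp only [merge, separate, exchange_unreroot b e₁, exchange_unreroot b e₂,
    sign_unreroot b e₁, sign_unreroot b e₂]
  refine Prod.ext (Eq.trans ?_ (rootAt_rootLeaf y.1)) rfl
  refine congrArg (Halves.rootAt y.1.halves) ?_
  rw [e] at hmem ⊢
  simp only [List.mem_cons, List.not_mem_nil, or_false] at hmem
  rcases hmem with h' | h' <;> simp [h', h]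

lemma mapsTo_merge (b : Bool) (d : ℕ+ →₀ ℕ) :
    Set.MapsTo (merge b) (leafMarkedPairs d) (edgeMarkedTrees d) := by
  rintro x ⟨m₁, m₂, s, t, hst, ⟨e₁, -, d₁⟩, e₂, -, d₂⟩
  have e₁' := isEulerian_exchange m₁ e₁
  have e₂' := isEulerian_exchange m₂ e₂
  obtain ⟨l, hl, e, -⟩ := exists_merge_eq b e₁' e₂'
  obtain ⟨hH, -⟩ := halves_rootAt hl
  have hi : (merge b x).1.IsInnerEdge := by
    rw [isInnerEdge_iff, e, hH]
    exact ⟨e₁'.1, e₂'.1⟩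
  refine ⟨hi, ?_, ?_, ?_⟩
  · rw [isEulerian_tree_iff hi, e, hH]
    exact ⟨e₁', e₂'⟩
  · rw [e]
    exact (mem_freeLeaves.1 hl).2
  · rw [hasDegreeDistribution_tree_iff hi, e, hH]
    exact ⟨s, t, hst, hasDegreeDistribution_exchange m₁ d₁, hasDegreeDistribution_exchange m₂ d₂⟩

lemma mapsTo_separate (b : Bool) (d : ℕ+ →₀ ℕ) :
    Set.MapsTo (separate b) (edgeMarkedTrees d) (leafMarkedPairs d) := by
  rintro y ⟨hi, he, hb, hd⟩
  obtain ⟨e₁, e₂⟩ := (isEulerian_tree_iff hi).1 he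
  obtain ⟨s, t, hst, d₁, d₂⟩ := (hasDegreeDistribution_tree_iff hi d).1 hd
  exact ⟨isMarkedTree_unreroot b e₁ _, isMarkedTree_unreroot b e₂ _, s, t, hst,
    unreroot_mem_balancedTrees b e₁ _ d₁, unreroot_mem_balancedTrees b e₂ _ d₂⟩

lemma invOn_separate_merge (b : Bool) (d : ℕ+ →₀ ℕ) :
    Set.InvOn (separate b) (merge b) (leafMarkedPairs d) (edgeMarkedTrees d) :=
  ⟨fun _ hx => separate_merge b hx, fun _ hy => merge_separate b hy⟩

end PlaneTree

end EulerianTrees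

theorem mainTheorem5 (countStart : Bool) (d : ℕ+ →₀ ℕ) :
    Set.BijOn (EulerianTrees.PlaneTree.merge countStart)
      (EulerianTrees.PlaneTree.leafMarkedPairs d) (EulerianTrees.PlaneTree.edgeMarkedTrees d) ∧
    Set.BijOn (EulerianTrees.PlaneTree.separate countStart)
      (EulerianTrees.PlaneTree.edgeMarkedTrees d) (EulerianTrees.PlaneTree.leafMarkedPairs d) ∧
    Set.InvOn (EulerianTrees.PlaneTree.separate countStart) (EulerianTrees.PlaneTree.merge countStart)
      (EulerianTrees.PlaneTree.leafMarkedPairs d) (EulerianTrees.PlaneTree.edgeMarkedTrees d) := by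
  have h := EulerianTrees.PlaneTree.invOn_separate_merge countStart d
  have hm := EulerianTrees.PlaneTree.mapsTo_merge countStart d
  have hs := EulerianTrees.PlaneTree.mapsTo_separate countStart d
  exact ⟨h.bijOn hm hs, h.symm.bijOn hs hm, h⟩
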